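/- Index the vertices of a tetrahedron by $1,2,3,4$. Let $AS(3)$ be the set of angle structures on the tetrahedron, i.e. of all $x=(x_{ij})_{1\le i<j\le 4}\in(0,\pi)^6$ (with $x_{ji}=x_{ij}$ the dihedral angle at the edge $v_iv_j$) such that $$x_{ij}+x_{ik}+x_{il}>\pi\quad\text{and}\quad x_{ij}+x_{ik}-x_{il}<\pi\qquad\text{whenever }\{i,j,k,l\}=\{1,2,3,4\};$$ equivalently, the dihedral angles at the three edges ending at any vertex are the inner angles of a spherical triangle. Let $E(3)$, $H(3)$, $S(3)\subset AS(3)$ be the sets of those $x$ that are the dihedral angles of a nondegenerate geodesic tetrahedron $v_1v_2v_3v_4$ in Euclidean space $E^3$, in hyperbolic space $H^3$, and in the sphere $S^3$, respectively. For $i\in\{1,2,3,4\}$ the $i$-th flip $F_i(x)=y$ of $x\in AS(3)$ is given by $y_{ij}=x_{ij}$ for $j\ne i$ and $y_{jk}=\pi-x_{jk}$ for distinct $j,k\neq i$; it is again an angle structure. **Proposition 6.1.** For every $x\in AS(3)$, exactly one of the following holds: (a) $x$ is a classical geometric tetrahedron, i.e. $x\in E(3)\cup H(3)\cup S(3)$;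 (b) there is a flip $F_i$ such that $F_i(x)\in E(3)\cup H(3)$; (c) there are two flips $F_i,F_j$, $i\ne j$, such that $F_iF_j(x)\in E(3)\cup H(3)$. -/

import Mathlib

/-!  Angle structures on a tetrahedron with vertices `v₀, v₁, v₂, v₃`, their flips, and the
Euclidean, spherical and hyperbolic tetrahedra measured by their dihedral angles. -/

namespace TetAngle

/-- A real number for each edge `vᵢvⱼ` is recorded as a function `x i j`; for the spaces below it is
symmetric with (by convention) zero diagonal, so that it amounts to six numbers. -/
abbrev EdgeFun : Type := Fin 4 → Fin 4 → ℝ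

/-- The space `AS(3)` of angle structures: dihedral angles in `(0, π)` such that the three angles at
the edges ending at a common vertex are the inner angles of a spherical triangle, that is,
satisfy the four inequalities below (the last one stands for three, by permuting `j, k, l`). -/
def AS3 : Set EdgeFun :=
  {x | (∀ i, x i i = 0) ∧ (∀ i j, x i j = x j i) ∧
    (∀ i j, i ≠ j → 0 < x i j ∧ x i j < Real.pi) ∧
    (∀ i j k l, [i, j, k, l].Nodup →
      Real.pi < x i j + x i k + x i l ∧ x i j + x i k - x i l < Real.pi)}

/-- The `i`-th flip: it keeps the angles at the edges ending at `vᵢ` and replaces the angle at each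
of the three edges of the face opposite to `vᵢ` by its supplement. -/
noncomputable def flip (i : Fin 4) (x : EdgeFun) : EdgeFun := fun a b =>
  if a = b ∨ a = i ∨ b = i then x a b else Real.pi - x a b

/-- `θ` is the angle, for the symmetric bilinear form `B`, between the two half-spaces
`S + ℝ₊ a` and `S + ℝ₊ b` bounded by the subspace `S`: it is the angle between the
components `u` of `a` and `w` of `b` that are `B`-orthogonal to `S`. (Where this is used, `B` is
nondegenerate on `S`, so that `u` and `w` exist and are unique, and `B` is positive on them.) -/
def IsAngleAlong {V : Type*} [AddCommGroup V] [Module ℝ V] (B : V → V → ℝ) (S : Submodule ℝ V)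
    (a b : V) (θ : ℝ) : Prop :=
  ∃ u w : V, a - u ∈ S ∧ b - w ∈ S ∧ (∀ s ∈ S, B s u = 0) ∧ (∀ s ∈ S, B s w = 0) ∧
    θ = Real.arccos (B u w / (√(B u u) * √(B w w)))

/-- The Lorentzian inner product on `ℝ⁴`. -/
def lorentz (u w : Fin 4 → ℝ) : ℝ := -(u 0 * w 0) + u 1 * w 1 + u 2 * w 2 + u 3 * w 3

/-- Hyperbolic 3-space: the upper sheet of the hyperboloid (with the metric induced by `lorentz`). -/
def hyperbolicSpace : Set (Fin 4 → ℝ) := {p | lorentz p p = -1 ∧ 0 < p 0}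

/-- `E(3)`: the angle structures formed by the dihedral angles of a nondegenerate tetrahedron in
Euclidean 3-space. The dihedral angle at the edge `pᵢpⱼ` is the angle between the half-planes
bounded by the line `pᵢpⱼ` that contain the two other vertices. -/
def E3 : Set EdgeFun :=
  {x | x ∈ AS3 ∧ ∃ p : Fin 4 → EuclideanSpace ℝ (Fin 3), AffineIndependent ℝ p ∧
    ∀ i j k l, [i, j, k, l].Nodup →
      IsAngleAlong (fun u w => inner ℝ u w) (Submodule.span ℝ {p j - p i})
        (p k - p i) (p l - p i) (x i j)}

/-- `S(3)`: the angle structures formed by the dihedral angles of a nondegenerate tetrahedron in the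
unit sphere of `ℝ⁴`. Its great-circle edge `pᵢpⱼ` spans a plane `S`; the component of `pₖ` orthogonal
to `S` is tangent to the sphere at each point of the edge, orthogonal to the edge, and points into
the face `pᵢpⱼpₖ`. -/
def S3 : Set EdgeFun :=
  {x | x ∈ AS3 ∧ ∃ p : Fin 4 → EuclideanSpace ℝ (Fin 4),
    (∀ i, p i ∈ Metric.sphere (0 : EuclideanSpace ℝ (Fin 4)) 1) ∧ LinearIndependent ℝ p ∧
    ∀ i j k l, [i, j, k, l].Nodup →
      IsAngleAlong (fun u w => inner ℝ u w) (Submodule.span ℝ {p i, p j})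
        (p k) (p l) (x i j)}

/-- `H(3)`: the angle structures formed by the dihedral angles of a nondegenerate tetrahedron in
hyperbolic 3-space; as for the sphere, with the Lorentzian inner product on the tangent spaces. -/
def H3 : Set EdgeFun :=
  {x | x ∈ AS3 ∧ ∃ p : Fin 4 → Fin 4 → ℝ,
    (∀ i, p i ∈ hyperbolicSpace) ∧ LinearIndependent ℝ p ∧
    ∀ i j k l, [i, j, k, l].Nodup →
      IsAngleAlong lorentz (Submodule.span ℝ {p i, p j}) (p k) (p l) (x i j)}

/-- Exactly one of three propositions holds. -/
def ExactlyOne (a b c : Prop) : Prop :=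
  (a ∧ ¬b ∧ ¬c) ∨ (¬a ∧ b ∧ ¬c) ∨ (¬a ∧ ¬b ∧ c)

end TetAngle

namespace TetAngle

open Matrix
open LinearMap (BilinForm)

/-! Everything is read off the Gram matrix `G = gram x` of the inward unit normals of the faces,
whose off-diagonal entries are minus the cosines of the dihedral angles. The vertex inequalities
make the diagonal cofactors positive (`adjugate_gram_diag_pos`), so three normals span a positive
definite space and only the sign of `det G` is open: positive, zero and negative correspond to
vectors in spherical, Euclidean and Lorentzian geometry (`exists_realization`).

If `det G > 0`, the dual basis of the normals, normalised, gives a spherical tetrahedron. If `det G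
≤ 0`, candidate vertices still exist, but they may lie on the wrong sides of the faces; a Euclidean
or hyperbolic tetrahedron exists iff all cofactors are positive (`mem_E3_union_H3_iff`). By Jacobi's
identities for minors of the adjugate, the cofactors `c i j` are nonzero and `c i j * c i k * c j k
> 0`, so their signs are `s i * s j` for a sign vector `s`, unique up to a global sign
(`adjugate_gram_signs`).

A flip negates one normal: it preserves `det G` and changes one entry of `s`. Four signs have a
minority of size zero, one or two, and these are the three cases. When `det G > 0`, flips never
reach `E3 ∪ H3`. -/

theorem sum_of_nodup {M : Type*} [AddCommMonoid M] {i j k l : Fin 4} (hd : [i, j, k, l].Nodup)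
    (f : Fin 4 → M) : ∑ a, f a = f i + f j + f k + f l := by
  have hu : (Finset.univ : Finset (Fin 4)) = {i, j, k, l} := by
    revert i j k l; decide
  simp only [List.nodup_cons, List.mem_cons, List.not_mem_nil, not_or] at hd
  rw [hu, Finset.sum_insert (by simp; tauto), Finset.sum_insert (by simp; tauto),
    Finset.sum_insert (by simp; tauto), Finset.sum_singleton]
  simp only [add_assoc]

/-! ### Dihedral angles, unit normals and dual vectors -/

section Angle
variable {V : Type*} [AddCommGroup V] [Module ℝ V]

/-- The component orthogonal to `S` of a vector dual to one of two unit normals of `S`. -/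
theorem eq_of_orthogonal_component (B : BilinForm ℝ V) (hs : ∀ u v, B u v = B v u)
    {S : Submodule ℝ V} {m n a u : V}
    (hm : ∀ s ∈ S, B m s = 0) (hn : ∀ s ∈ S, B n s = 0)
    (hperp : ∀ v, (∀ s ∈ S, B s v = 0) → ∃ α β : ℝ, v = α • m + β • n)
    (hmm : B m m = 1) (hnn : B n n = 1) (hlt : B m n ^ 2 < 1) (ha : B n a = 0)
    (hau : a - u ∈ S) (hu : ∀ s ∈ S, B s u = 0) :
    u = (B m a / (1 - B m n ^ 2)) • (m - B m n • n) := by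
  obtain ⟨α, β, rfl⟩ := hperp u hu
  have h1 := hm _ hau
  have h2 := hn _ hau
  simp only [map_sub, map_add, map_smul, smul_eq_mul, hmm, hnn, ha, hs n m] at h1 h2
  have hD : (1 - B m n ^ 2) ≠ 0 := by linarith
  have hβ : β = -(α * B m n) := by linarith
  have hα : α = B m a / (1 - B m n ^ 2) := by
    rw [eq_div_iff hD]; rw [hβ] at h1; linarith
  rw [← hα, hβ, smul_sub, smul_smul, neg_smul, sub_eq_add_neg]

/-- With `c = B m n`, the components of `a` and `b` orthogonal to `S` are positive multiples of `m -
c • n` and `n - c • m`. Both of these have square `1 - c ^ 2`, and their product is `-c * (1 - c ^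
2)`, so the cosine is `-c`. -/
theorem isAngleAlong_iff (B : BilinForm ℝ V) (hs : ∀ u v, B u v = B v u)
    {S : Submodule ℝ V} {m n a b : V}
    (hS : ∀ v, v ∈ S ↔ B m v = 0 ∧ B n v = 0)
    (hperp : ∀ v, (∀ s ∈ S, B s v = 0) → ∃ α β : ℝ, v = α • m + β • n)
    (hmm : B m m = 1) (hnn : B n n = 1) (hlt : B m n ^ 2 < 1)
    (hma : 0 < B m a) (hna : B n a = 0) (hmb : B m b = 0) (hnb : 0 < B n b) (θ : ℝ) :
    IsAngleAlong (fun u w => B u w) S a b θ ↔ θ = Real.arccos (-B m n) := by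
  have hD : 0 < 1 - B m n ^ 2 := by linarith
  have hval : ∀ x y : ℝ, 0 < x → 0 < y →
      B ((x / (1 - B m n ^ 2)) • (m - B m n • n)) ((y / (1 - B m n ^ 2)) • (n - B m n • m)) /
        (√(B ((x / (1 - B m n ^ 2)) • (m - B m n • n)) ((x / (1 - B m n ^ 2)) • (m - B m n • n))) *
         √(B ((y / (1 - B m n ^ 2)) • (n - B m n • m)) ((y / (1 - B m n ^ 2)) • (n - B m n • m))))
        = - B m n := by
    intro x y hx hy
    have h1 : B ((x / (1 - B m n ^ 2)) • (m - B m n • n)) ((x / (1 - B m n ^ 2)) • (m - B m n • n))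
        = x ^ 2 / (1 - B m n ^ 2) := by
      simp only [map_sub, map_smul, smul_eq_mul, LinearMap.smul_apply, LinearMap.sub_apply, hmm,
        hnn, hs n m]
      field_simp
      ring
    have h2 : B ((y / (1 - B m n ^ 2)) • (n - B m n • m)) ((y / (1 - B m n ^ 2)) • (n - B m n • m))
        = y ^ 2 / (1 - B m n ^ 2) := by
      simp only [map_sub, map_smul, smul_eq_mul, LinearMap.smul_apply, LinearMap.sub_apply, hmm,
        hnn, hs n m]
      field_simp
      ring
    rw [h1, h2, ← Real.sqrt_mul (by positivity), show x ^ 2 / (1 - B m n ^ 2) *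
      (y ^ 2 / (1 - B m n ^ 2)) = (x * y / (1 - B m n ^ 2)) ^ 2 by ring,
      Real.sqrt_sq (by positivity)]
    simp only [map_sub, map_smul, smul_eq_mul, LinearMap.smul_apply, LinearMap.sub_apply, hmm,
      hnn, hs n m]
    field_simp
    ring
  constructor
  · rintro ⟨u, w, hu, hw, hsu, hsw, rfl⟩
    have e1 := eq_of_orthogonal_component B hs (fun s h => ((hS s).1 h).1)
      (fun s h => ((hS s).1 h).2) hperp hmm hnn hlt hna hu hsu
    have e2 := eq_of_orthogonal_component B hs (fun s h => ((hS s).1 h).2)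
      (fun s h => ((hS s).1 h).1) (fun v hv => by
        obtain ⟨α, β, h⟩ := hperp v hv; exact ⟨β, α, by rw [h, add_comm]⟩)
      hnn hmm (by rwa [hs n m]) hmb hw hsw
    rw [hs n m] at e2
    rw [e1, e2, hval _ _ hma hnb]
  · rintro rfl
    refine ⟨(B m a / (1 - B m n ^ 2)) • (m - B m n • n), (B n b / (1 - B m n ^ 2)) • (n - B m n • m),
      ?_, ?_, ?_, ?_, ?_⟩
    · rw [hS]
      simp only [map_sub, map_smul, smul_eq_mul, hmm, hnn, hna, hs n m]
      constructor <;> field_simp <;> ring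
    · rw [hS]
      simp only [map_sub, map_smul, smul_eq_mul, hmm, hnn, hmb, hs n m]
      constructor <;> field_simp <;> ring
    · intro s h
      simp [hs s, (hS s).1 h]
    · intro s h
      simp [hs s, (hS s).1 h]
    · beta_reduce
      rw [hval _ _ hma hnb]

/-- The dihedral angle between two facets, given by their unit normals. The edge is spanned by
`e i` and `e j`, one of which is allowed to vanish. -/
theorem isAngleAlong_span_pair_iff (B : BilinForm ℝ V) (hs : ∀ u v, B u v = B v u)
    (hnd : ∀ v, (∀ w, B w v = 0) → v = 0) {e n : Fin 4 → V} {c : Fin 4 → ℝ}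
    (hexp : ∀ w, w = ∑ a, (c a * B (n a) w) • e a) {i j k l : Fin 4} (hd : [i, j, k, l].Nodup)
    (hk : ∀ a, a ≠ k → B (n k) (e a) = 0) (hl : ∀ a, a ≠ l → B (n l) (e a) = 0)
    (hkk : 0 < B (n k) (e k)) (hll : 0 < B (n l) (e l))
    (nk : B (n k) (n k) = 1) (nl : B (n l) (n l) = 1) (hlt : B (n k) (n l) ^ 2 < 1) (θ : ℝ) :
    IsAngleAlong (fun u w => B u w) (Submodule.span ℝ {e i, e j}) (e k) (e l) θ ↔
      θ = Real.arccos (-B (n k) (n l)) := by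
  have hne : i ≠ k ∧ j ≠ k ∧ i ≠ l ∧ j ≠ l ∧ k ≠ l := by
    simp only [List.nodup_cons, List.mem_cons, List.not_mem_nil, not_or] at hd
    tauto
  obtain ⟨hik, hjk, hil, hjl, hkl⟩ := hne
  refine isAngleAlong_iff B hs (fun v => ⟨?_, ?_⟩) ?_ nk nl hlt hkk (hl k hkl) (hk l hkl.symm) hll θ
  · intro hv
    obtain ⟨x, y, rfl⟩ := Submodule.mem_span_pair.1 hv
    simp [hk i hik, hk j hjk, hl i hil, hl j hjl]
  · rintro ⟨h1, h2⟩
    rw [hexp v, sum_of_nodup hd]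
    simp only [h1, h2, mul_zero, zero_smul, add_zero]
    exact Submodule.mem_span_pair.2 ⟨_, _, rfl⟩
  · intro v hv
    -- Pairing the expansion of an arbitrary `w` with `v` leaves only the terms of `k` and `l`;
    -- nondegeneracy then identifies `v`.
    refine ⟨c k * B (e k) v, c l * B (e l) v, sub_eq_zero.1 (hnd _ fun w => ?_)⟩
    have hi := hv (e i) (Submodule.subset_span (by simp))
    have hj := hv (e j) (Submodule.subset_span (by simp))
    have hw : B w v = ∑ a, (c a * B (n a) w) * B (e a) v := by
      conv_lhs => rw [hexp w]
      simp
    rw [sum_of_nodup hd, hi, hj] at hw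
    rw [map_sub, map_add, map_smul, map_smul, hw, hs w (n k), hs w (n l)]
    simp only [smul_eq_mul]
    ring

/-- A family that is dual to a family of normals, up to nonzero factors, is independent. -/
theorem linearIndependent_of_dual (B : BilinForm ℝ V) {ι : Type*} [Finite ι] [DecidableEq ι]
    {n p : ι → V} {lam : ι → ℝ} (hlam : ∀ i, lam i ≠ 0)
    (h : ∀ i j, B (n i) (p j) = if i = j then lam i else 0) : LinearIndependent ℝ p := by
  cases nonempty_fintype ι
  rw [Fintype.linearIndependent_iff]
  intro g hg i
  have := congrArg (B (n i)) hg
  simpa [h, hlam] using this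

theorem eq_sum_of_dual [FiniteDimensional ℝ V] (B : BilinForm ℝ V) {ι : Type*} [Fintype ι]
    [DecidableEq ι]
    {n p : ι → V} {lam : ι → ℝ} (hlam : ∀ i, lam i ≠ 0)
    (hcard : Fintype.card ι = Module.finrank ℝ V)
    (h : ∀ i j, B (n i) (p j) = if i = j then lam i else 0) (w : V) :
    w = ∑ a, ((lam a)⁻¹ * B (n a) w) • p a := by
  have hli := linearIndependent_of_dual B hlam h
  have hsp := hli.span_eq_top_of_card_eq_finrank' hcard
  have hw : w ∈ Submodule.span ℝ (Set.range p) := by rw [hsp]; trivial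
  obtain ⟨g, rfl⟩ := (Submodule.mem_span_range_iff_exists_fun ℝ).1 hw
  refine Finset.sum_congr rfl fun a _ => ?_
  have : (lam a)⁻¹ * (g a * lam a) = g a := by
    have := hlam a
    field_simp
  simp [h, this]

/-- The normals determine the vertices. -/
theorem exists_dual (B : BilinForm ℝ V) {ι : Type*} [Fintype ι] [DecidableEq ι] {n : ι → V}
    {G : Matrix ι ι ℝ} (hG : ∀ i j, B (n i) (n j) = G i j) (hsymm : G.transpose = G)
    (hdet : G.det ≠ 0) : ∃ p : ι → V, (∀ i j, B (n i) (p j) = if i = j then 1 else 0) ∧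
      ∀ i j, B (p i) (p j) = G⁻¹ i j := by
  have hu : IsUnit G.det := isUnit_iff_ne_zero.2 hdet
  have h1 : ∀ i j, B (n i) (∑ k, G⁻¹ j k • n k) = if i = j then 1 else 0 := by
    intro i j
    have := congrFun (congrFun (Matrix.mul_nonsing_inv G hu) i) j
    rw [Matrix.mul_apply, Matrix.one_apply] at this
    rw [← this]
    simp only [map_sum, map_smul, smul_eq_mul, hG]
    refine Finset.sum_congr rfl fun k _ => ?_
    have : G⁻¹ j k = G⁻¹ k j := by
      conv_lhs => rw [← hsymm, ← Matrix.transpose_nonsing_inv, Matrix.transpose_apply]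
    rw [this, mul_comm]
  refine ⟨fun j => ∑ k, G⁻¹ j k • n k, h1, fun i j => ?_⟩
  have h2 := fun i => h1 i j
  change B (∑ k, G⁻¹ i k • n k) (∑ k, G⁻¹ j k • n k) = _
  generalize (∑ k, G⁻¹ j k • n k) = y at h2
  rw [LinearMap.map_sum₂]
  simp [h2]

/-- The vertices determine unit normals, if the form is positive on the complement of each. -/
theorem exists_unit_normals [FiniteDimensional ℝ V] (hV : Module.finrank ℝ V = 4)
    (B : BilinForm ℝ V) (hs : ∀ u v, B u v = B v u) (hnd : ∀ v, (∀ w, B w v = 0) → v = 0)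
    {p : Fin 4 → V} (hp : LinearIndependent ℝ p)
    (hpos : ∀ i v, v ≠ 0 → B v (p i) = 0 → 0 < B v v) :
    ∃ (n : Fin 4 → V) (lam : Fin 4 → ℝ), (∀ i, 0 < lam i) ∧
      (∀ i j, B (n i) (p j) = if i = j then lam i else 0) ∧ (∀ i, B (n i) (n i) = 1) ∧
      ∀ i j, i ≠ j → B (n i) (n j) ^ 2 < 1 := by
  have hB : B.Nondegenerate := by
    constructor
    · intro v hv; exact hnd v fun w => by rw [hs]; exact hv w
    · intro v hv; exact hnd v hv
  let b := basisOfLinearIndependentOfCardEqFinrank hp (by simp [hV])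
  have hb : ∀ i, b i = p i := fun i => by simp [b]
  let q := B.dualBasis hB b
  have hq : ∀ i j, B (q i) (p j) = if i = j then 1 else 0 := by
    intro i j
    rw [← hb, BilinForm.apply_dualBasis_left]
    simp [eq_comm]
  have hother : ∀ i : Fin 4, ∃ j, j ≠ i := by decide
  have hother2 : ∀ i j : Fin 4, ∃ k, i ≠ k ∧ j ≠ k := by decide
  have hqq : ∀ i, 0 < B (q i) (q i) := by
    intro i
    obtain ⟨j, hj⟩ := hother i
    exact hpos j _ (q.ne_zero i) (by rw [hq, if_neg hj.symm])
  have hsq : ∀ i, 0 < √(B (q i) (q i)) := fun i => Real.sqrt_pos.2 (hqq i)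
  have hn : ∀ i j, B ((√(B (q i) (q i)))⁻¹ • q i) (p j) =
      if i = j then (√(B (q i) (q i)))⁻¹ else 0 := by
    intro i j; simp [hq]
  have hn1 : ∀ i, B ((√(B (q i) (q i)))⁻¹ • q i) ((√(B (q i) (q i)))⁻¹ • q i) = 1 := by
    intro i
    have := Real.mul_self_sqrt (hqq i).le
    have h0 := (hsq i).ne'
    simp only [map_smul, LinearMap.smul_apply, smul_eq_mul]
    field_simp
    linarith
  refine ⟨fun i => (√(B (q i) (q i)))⁻¹ • q i, fun i => (√(B (q i) (q i)))⁻¹,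
    fun i => inv_pos.2 (hsq i), hn, hn1, fun i j hij => ?_⟩
  set n : Fin 4 → V := fun i => (√(B (q i) (q i)))⁻¹ • q i with hndef
  obtain ⟨k, hik, hjk⟩ := hother2 i j
  have hn' : ∀ i j, B (n i) (p j) = if i = j then (√(B (q i) (q i)))⁻¹ else 0 := hn
  have hn1' : ∀ i, B (n i) (n i) = 1 := hn1
  -- The part of `n i` orthogonal to `n j` is nonzero and orthogonal to a third vertex `p k`, so its
  -- square `1 - B (n i) (n j) ^ 2` is positive.
  have h := hpos k (n i - B (n i) (n j) • n j) ?_ ?_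
  · simp only [map_sub, map_smul, smul_eq_mul, LinearMap.smul_apply, LinearMap.sub_apply, hn1',
      hs (n j) (n i)] at h
    change B (n i) (n j) ^ 2 < 1
    nlinarith
  · intro h0
    have := congrArg (fun v => B v (p i)) h0
    simp [hn', hij.symm, (hsq i).ne'] at this
  · simp [hn', hik, hjk]

end Angle

/-! ### The Gram matrix, its behaviour under flips and the signs of its cofactors -/

/-- The Gram matrix of the unit normals of the faces, face `k` being opposite to vertex `k`. -/
noncomputable def gram (x : EdgeFun) : Matrix (Fin 4) (Fin 4) ℝ :=
  !![1, -Real.cos (x 2 3), -Real.cos (x 1 3), -Real.cos (x 1 2);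
     -Real.cos (x 2 3), 1, -Real.cos (x 0 3), -Real.cos (x 0 2);
     -Real.cos (x 1 3), -Real.cos (x 0 3), 1, -Real.cos (x 0 1);
     -Real.cos (x 1 2), -Real.cos (x 0 2), -Real.cos (x 0 1), 1]

theorem gram_apply {x : EdgeFun} (hx : ∀ i j, x i j = x j i) {i j k l : Fin 4}
    (hd : [i, j, k, l].Nodup) : gram x k l = -Real.cos (x i j) := by
  revert hd
  fin_cases i <;> fin_cases j <;> fin_cases k <;> fin_cases l <;> intro hd <;>
    first
    | (exfalso; revert hd; decide)
    | (first | rfl | (rw [hx]; rfl))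

theorem gram_diag (x : EdgeFun) (i : Fin 4) : gram x i i = 1 := by
  fin_cases i <;> rfl

theorem gram_transpose (x : EdgeFun) : (gram x).transpose = gram x := by
  ext i j
  fin_cases i <;> fin_cases j <;> rfl

theorem exists_complement {k l : Fin 4} (h : k ≠ l) : ∃ i j, [i, j, k, l].Nodup := by
  revert k l; decide

theorem gram_sq_lt {x : EdgeFun} (hx : x ∈ AS3) {k l : Fin 4} (h : k ≠ l) :
    gram x k l ^ 2 < 1 := by
  obtain ⟨i, j, hd⟩ := exists_complement h
  have hij : i ≠ j := by
    intro h; subst h; simp at hd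
  obtain ⟨h0, hpi⟩ := hx.2.2.1 i j hij
  rw [gram_apply hx.2.1 hd]
  have := Real.sin_pos_of_pos_of_lt_pi h0 hpi
  nlinarith [Real.sin_sq_add_cos_sq (x i j)]

/-- A flip acts on the normals by negating the `i`-th one, since `cos (π - t) = -cos t`. -/
theorem gram_flip (i : Fin 4) (x : EdgeFun) (k l : Fin 4) :
    gram (flip i x) k l =
      (if k = i then -1 else 1) * (if l = i then -1 else 1) * gram x k l := by
  fin_cases i <;> fin_cases k <;> fin_cases l <;> simp [gram, flip, Real.cos_pi_sub]

theorem nodup_swap {i j k l : Fin 4} (h : [i, j, k, l].Nodup) : [i, j, l, k].Nodup := by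
  revert i j k l; decide

theorem nodup_rotate {i j k l : Fin 4} (h : [i, j, k, l].Nodup) : [i, k, l, j].Nodup := by
  revert i j k l; decide

theorem eq_or_of_nodup {i j k l : Fin 4} (h : [i, j, k, l].Nodup) (a : Fin 4) :
    a = i ∨ a = j ∨ a = k ∨ a = l := by
  revert i j k l a; decide

/-- At `v_a` nothing changes. At any other vertex two of the three angles become supplements, which
permutes the four spherical triangle inequalities. -/
theorem flip_mem_AS3 {x : EdgeFun} (hx : x ∈ AS3) (a : Fin 4) : flip a x ∈ AS3 := by
  obtain ⟨h0, hs, hb, hv⟩ := hx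
  refine ⟨fun i => by simp [flip, h0], fun i j => ?_, fun i j hij => ?_, fun i j k l hd => ?_⟩
  · simp only [flip, eq_comm (a := i) (b := j), hs i j, or_comm (a := i = a)]
  · have := hb i j hij
    simp only [flip]
    split_ifs
    · exact this
    · constructor <;> linarith
  · have h1 := hv i j k l hd
    have h2 := hv i j l k (nodup_swap hd)
    have h3 := hv i k l j (nodup_rotate hd)
    have ha := eq_or_of_nodup hd a
    simp only [List.nodup_cons, List.mem_cons, List.not_mem_nil, not_or] at hd
    obtain ⟨⟨hij, hik, hil, -⟩, ⟨hjk, hjl, -⟩, ⟨hkl, -⟩, -⟩ := hd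
    rcases ha with rfl | rfl | rfl | rfl
    all_goals
      simp [flip, hij, hik, hil, hjk, hjl, hkl, Ne.symm hij, Ne.symm hik, Ne.symm hil,
        Ne.symm hjk, Ne.symm hjl, Ne.symm hkl]
      constructor <;> linarith

/-- `G'` is `D * G * D` for the diagonal sign matrix `D`, and `D.adjugate = D.det • D` with `D.det ^
2 = 1`. -/
theorem det_of_signs {G G' : Matrix (Fin 4) (Fin 4) ℝ} {ε : Fin 4 → ℝ} (hε : ∀ k, ε k ^ 2 = 1)
    (h : ∀ k l, G' k l = ε k * ε l * G k l) :
    G'.det = G.det ∧ ∀ k l, G'.adjugate k l = ε k * ε l * G.adjugate k l := by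
  have hG : G' = diagonal ε * G * diagonal ε := by
    ext k l
    rw [mul_diagonal, diagonal_mul, h]; ring
  have hd : (diagonal ε).det * (diagonal ε).det = 1 := by
    rw [← pow_two, det_diagonal, ← Finset.prod_pow]; simp [hε]
  have hE : (diagonal ε).adjugate = (diagonal ε).det • diagonal ε := by
    have h1 : diagonal ε * diagonal ε = 1 := by
      rw [diagonal_mul_diagonal, ← diagonal_one]
      congr 1; ext k; rw [← pow_two, hε]
    calc (diagonal ε).adjugate = (diagonal ε).adjugate * (diagonal ε * diagonal ε) := by
          rw [h1, mul_one]
      _ = _ := by rw [← mul_assoc, adjugate_mul, smul_mul, one_mul]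
  constructor
  · rw [hG, det_mul, det_mul]
    linear_combination G.det * hd
  · intro k l
    rw [hG, adjugate_mul_distrib, adjugate_mul_distrib, hE]
    rw [smul_mul, Matrix.mul_smul, Matrix.mul_smul, smul_smul, hd, one_smul, diagonal_mul,
      mul_diagonal]
    ring

/-- The expression factors as `-(cos (β + γ) + cos α) * (cos α + cos (β - γ))`. Each factor becomes
a product of cosines of half-sums, whose signs follow from the inequalities; the last three of these
add up to `α + β + γ < 3π`. -/
theorem spherical_gram_det_pos {α β γ : ℝ} (h : Real.pi < α + β + γ) (h1 : α + β - γ < Real.pi)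
    (h2 : α + γ - β < Real.pi) (h3 : β + γ - α < Real.pi) :
    0 < 1 - Real.cos α ^ 2 - Real.cos β ^ 2 - Real.cos γ ^ 2
      - 2 * Real.cos α * Real.cos β * Real.cos γ := by
  have n1 : Real.cos ((α + β + γ) / 2) < 0 :=
    Real.cos_neg_of_pi_div_two_lt_of_lt (by linarith) (by linarith)
  have n2 : 0 < Real.cos ((β + γ - α) / 2) :=
    Real.cos_pos_of_mem_Ioo ⟨by linarith, by linarith⟩
  have n3 : 0 < Real.cos ((α + γ - β) / 2) :=
    Real.cos_pos_of_mem_Ioo ⟨by linarith, by linarith⟩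
  have n4 : 0 < Real.cos ((α + β - γ) / 2) :=
    Real.cos_pos_of_mem_Ioo ⟨by linarith, by linarith⟩
  have c1 : Real.cos (β + γ) + Real.cos α < 0 := by
    rw [Real.cos_add_cos, show (β + γ + α) / 2 = (α + β + γ) / 2 by ring]
    nlinarith [mul_pos_of_neg_of_neg n1 (neg_lt_zero.2 n2)]
  have c2 : 0 < Real.cos α + Real.cos (β - γ) := by
    rw [Real.cos_add_cos, show (α + (β - γ)) / 2 = (α + β - γ) / 2 by ring,
      show (α - (β - γ)) / 2 = (α + γ - β) / 2 by ring]
    positivity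
  rw [Real.cos_add] at c1
  rw [Real.cos_sub] at c2
  have h4 := mul_pos (neg_pos.2 c1) c2
  have e : Real.sin β ^ 2 * Real.sin γ ^ 2 = (1 - Real.cos β ^ 2) * (1 - Real.cos γ ^ 2) := by
    rw [Real.sin_sq, Real.sin_sq]
  nlinarith

/-- Deleting row and column `i` leaves the three faces through `v_i`, so this cofactor is the Gram
determinant of the spherical triangle at that vertex. -/
theorem adjugate_gram_diag_pos {x : EdgeFun} (hx : x ∈ AS3) (i : Fin 4) :
    0 < (gram x).adjugate i i := by
  have key : ∀ i j k l : Fin 4, [i, j, k, l].Nodup → 0 < 1 - Real.cos (x i j) ^ 2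
      - Real.cos (x i k) ^ 2 - Real.cos (x i l) ^ 2
      - 2 * Real.cos (x i j) * Real.cos (x i k) * Real.cos (x i l) := by
    intro i j k l hd
    have h1 := hx.2.2.2 i j k l hd
    have h2 := hx.2.2.2 i j l k (nodup_swap hd)
    have h3 := hx.2.2.2 i k l j (nodup_rotate hd)
    exact spherical_gram_det_pos h1.1 h1.2 h2.2 h3.2
  have hs := hx.2.1
  rw [adjugate_fin_succ_eq_det_submatrix, det_fin_three]
  fin_cases i
  · have := key 0 1 2 3 (by decide)
    simp [gram]
    linarith
  · have := key 1 0 2 3 (by decide)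
    rw [hs 1 0] at this
    simp [gram, Fin.succAbove]
    linarith
  · have := key 2 0 1 3 (by decide)
    rw [hs 2 0, hs 2 1] at this
    simp [gram, Fin.succAbove]
    linarith
  · have := key 3 0 1 2 (by decide)
    rw [hs 3 0, hs 3 1, hs 3 2] at this
    simp [gram, Fin.succAbove]
    linarith

/-- Jacobi: a principal 2×2 minor of the adjugate is `det` times the complementary minor, here `det
* (1 - g ^ 2) ≤ 0` for an entry `g`. Hence the square of an off-diagonal cofactor is at least the
product of the two diagonal ones. The 3×3 minor is `det ^ 2` times a diagonal entry `1`; inserting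
the previous bounds leaves a positive lower bound for the triple product. -/
theorem adjugate_signs_aux {a b c d e f : ℝ} {A : Matrix (Fin 4) (Fin 4) ℝ}
    (hA : A = !![1, a, b, c; a, 1, d, e; b, d, 1, f; c, e, f, 1])
    (hd : A.det ≤ 0) (hpos : ∀ i, 0 < A.adjugate i i) (he1 : e ^ 2 < 1)
    (hf1 : f ^ 2 < 1) (hc1 : c ^ 2 < 1) :
    A.adjugate 0 1 ≠ 0 ∧ 0 < A.adjugate 0 1 * A.adjugate 0 2 * A.adjugate 1 2 := by
  have h0 : A.adjugate 0 0 = 1 - d ^ 2 - e ^ 2 - f ^ 2 + 2 * d * e * f := by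
    rw [hA, adjugate_fin_succ_eq_det_submatrix, det_fin_three]; simp; ring
  have h1 : A.adjugate 1 1 = 1 - b ^ 2 - c ^ 2 - f ^ 2 + 2 * b * c * f := by
    rw [hA, adjugate_fin_succ_eq_det_submatrix, det_fin_three]; simp [Fin.succAbove]; ring
  have h2 : A.adjugate 2 2 = 1 - a ^ 2 - c ^ 2 - e ^ 2 + 2 * a * c * e := by
    rw [hA, adjugate_fin_succ_eq_det_submatrix, det_fin_three]; simp [Fin.succAbove]; ring
  have h01 : A.adjugate 0 1 = -(a * (1 - f ^ 2) - b * d + c * d * f + b * e * f - c * e) := by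
    rw [hA, adjugate_fin_succ_eq_det_submatrix, det_fin_three]; simp [Fin.succAbove]; ring
  have h02 : A.adjugate 0 2 = -(b * (1 - e ^ 2) - a * d + c * d * e + a * e * f - c * f) := by
    rw [hA, adjugate_fin_succ_eq_det_submatrix, det_fin_three]; simp [Fin.succAbove]; ring
  have h12 : A.adjugate 1 2 = -(d * (1 - c ^ 2) - a * b + b * c * e + a * c * f - e * f) := by
    rw [hA, adjugate_fin_succ_eq_det_submatrix, det_fin_three]; simp [Fin.succAbove]; ring
  have hdet : A.det = 1 - a ^ 2 - b ^ 2 - c ^ 2 - d ^ 2 - e ^ 2 - f ^ 2 + a ^ 2 * f ^ 2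
      + b ^ 2 * e ^ 2 + c ^ 2 * d ^ 2 + 2 * (a * b * d + a * c * e + b * c * f + d * e * f)
      - 2 * (a * b * e * f + a * c * d * f + b * c * d * e) := by
    rw [hA, det_succ_row_zero]; simp [Fin.sum_univ_succ, det_fin_three, Fin.succAbove]; ring
  have j01 : A.adjugate 0 0 * A.adjugate 1 1 - A.adjugate 0 1 ^ 2 = A.det * (1 - f ^ 2) := by
    rw [h0, h1, h01, hdet]; ring
  have j02 : A.adjugate 0 0 * A.adjugate 2 2 - A.adjugate 0 2 ^ 2 = A.det * (1 - e ^ 2) := by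
    rw [h0, h2, h02, hdet]; ring
  have j12 : A.adjugate 1 1 * A.adjugate 2 2 - A.adjugate 1 2 ^ 2 = A.det * (1 - c ^ 2) := by
    rw [h1, h2, h12, hdet]; ring
  have j012 : A.adjugate 0 0 * A.adjugate 1 1 * A.adjugate 2 2
      + 2 * (A.adjugate 0 1 * A.adjugate 0 2 * A.adjugate 1 2)
      - A.adjugate 0 0 * A.adjugate 1 2 ^ 2 - A.adjugate 1 1 * A.adjugate 0 2 ^ 2
      - A.adjugate 2 2 * A.adjugate 0 1 ^ 2 = A.det ^ 2 := by
    rw [h0, h1, h2, h01, h02, h12, hdet]; ring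
  have p0 := hpos 0
  have p1 := hpos 1
  have p2 := hpos 2
  have q01 : A.adjugate 0 0 * A.adjugate 1 1 ≤ A.adjugate 0 1 ^ 2 := by
    linarith [mul_nonpos_of_nonpos_of_nonneg hd (sub_nonneg.2 hf1.le)]
  have q02 : A.adjugate 0 0 * A.adjugate 2 2 ≤ A.adjugate 0 2 ^ 2 := by
    linarith [mul_nonpos_of_nonpos_of_nonneg hd (sub_nonneg.2 he1.le)]
  have q12 : A.adjugate 1 1 * A.adjugate 2 2 ≤ A.adjugate 1 2 ^ 2 := by
    linarith [mul_nonpos_of_nonpos_of_nonneg hd (sub_nonneg.2 hc1.le)]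
  constructor
  · intro h
    rw [h] at q01
    linarith [mul_pos p0 p1]
  · have t0 := mul_le_mul_of_nonneg_left q12 p0.le
    have t1 := mul_le_mul_of_nonneg_left q02 p1.le
    have t2 := mul_le_mul_of_nonneg_left q01 p2.le
    have t := mul_pos (mul_pos p0 p1) p2
    have tt := sq_nonneg A.det
    clear h0 h1 h2 h01 h02 h12 hdet hA j01 j02 j12
    linarith

/-- If the determinant is not positive, the cofactors have the signs of a rank one matrix. -/
theorem adjugate_gram_signs {x : EdgeFun} (hx : x ∈ AS3) (hd : (gram x).det ≤ 0)
    {i j k l : Fin 4} (hn : [i, j, k, l].Nodup) :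
    (gram x).adjugate i j ≠ 0 ∧
      0 < (gram x).adjugate i j * (gram x).adjugate i k * (gram x).adjugate j k := by
  have hinj : Function.Injective ![i, j, k, l] := by
    revert i j k l; decide
  -- Relabelling the vertices reduces the claim to the indices `0, 1, 2` of a matrix in the explicit
  -- form above.
  let σ : Fin 4 ≃ Fin 4 := Equiv.ofBijective _ (Finite.injective_iff_bijective.1 hinj)
  have hσ : ∀ a, σ a = ![i, j, k, l] a := fun a => rfl
  have hadj : ∀ a b, ((gram x).submatrix σ σ).adjugate a b = (gram x).adjugate (σ a) (σ b) := by
    intro a b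
    rw [adjugate_submatrix_equiv_self]; rfl
  have hsymm : ∀ a b, gram x a b = gram x b a := fun a b =>
    congrFun (congrFun (gram_transpose x) b) a
  have hne : ∀ {a b}, a ≠ b → gram x (σ a) (σ b) ^ 2 < 1 := fun h =>
    gram_sq_lt hx (σ.injective.ne h)
  have := adjugate_signs_aux (A := (gram x).submatrix σ σ) (a := gram x i j) (b := gram x i k)
    (c := gram x i l) (d := gram x j k) (e := gram x j l) (f := gram x k l) ?_ ?_ ?_
    (hne (a := 1) (b := 3) (by decide))
    (hne (a := 2) (b := 3) (by decide)) (hne (a := 0) (b := 3) (by decide))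
  · simp only [hadj] at this
    exact this
  · ext a b
    fin_cases a <;> fin_cases b <;> simp [hσ, gram_diag, hsymm j i, hsymm k i, hsymm l i,
      hsymm k j, hsymm l j, hsymm l k]
  · rwa [det_submatrix_equiv_self]
  · intro a
    rw [hadj]
    exact adjugate_gram_diag_pos hx _

/-! ### Normals and vertices for forms on a four-dimensional space -/

section Common
variable {V : Type*} [AddCommGroup V] [Module ℝ V]

/-- If the dihedral angles are measured by unit normals, their Gram matrix is the one of `x`. -/
theorem gram_eq_of_arccos {x : EdgeFun} (hx : x ∈ AS3) {B : BilinForm ℝ V} {n : Fin 4 → V}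
    (h1 : ∀ i, B (n i) (n i) = 1) (hlt : ∀ i j, i ≠ j → B (n i) (n j) ^ 2 < 1)
    (h : ∀ i j k l, [i, j, k, l].Nodup → x i j = Real.arccos (-B (n k) (n l))) (k l : Fin 4) :
    B (n k) (n l) = gram x k l := by
  rcases eq_or_ne k l with rfl | hkl
  · rw [h1, gram_diag]
  · obtain ⟨i, j, hd⟩ := exists_complement hkl
    have h2 := (sq_lt_one_iff_abs_lt_one _).1 (hlt k l hkl)
    rw [abs_lt] at h2
    rw [gram_apply hx.2.1 hd, h i j k l hd, Real.cos_arccos (by linarith) (by linarith), neg_neg]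

theorem arccos_of_gram_eq {x : EdgeFun} (hx : x ∈ AS3) {B : BilinForm ℝ V} {n : Fin 4 → V}
    (h : ∀ k l, B (n k) (n l) = gram x k l) {i j k l : Fin 4} (hd : [i, j, k, l].Nodup) :
    x i j = Real.arccos (-B (n k) (n l)) := by
  have hij : i ≠ j := by rintro rfl; simp at hd
  have := hx.2.2.1 i j hij
  rw [h, gram_apply hx.2.1 hd, neg_neg, Real.arccos_cos this.1.le this.2.le]

theorem ne_of_nodup {i j k l : Fin 4} (hd : [i, j, k, l].Nodup) : k ≠ l := by
  rintro rfl; simp at hd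

/-- The dihedral angle condition in terms of the normals, for forms on a four-dimensional space. -/
theorem isAngleAlong_iff_of_dual [FiniteDimensional ℝ V] (hV : Module.finrank ℝ V = 4)
    (B : BilinForm ℝ V) (hs : ∀ u v, B u v = B v u) (hnd : ∀ v, (∀ w, B w v = 0) → v = 0)
    {n p : Fin 4 → V} {lam : Fin 4 → ℝ} (hlam : ∀ i, 0 < lam i)
    (hnp : ∀ i j, B (n i) (p j) = if i = j then lam i else 0) (h1 : ∀ i, B (n i) (n i) = 1)
    (hlt : ∀ i j, i ≠ j → B (n i) (n j) ^ 2 < 1) {i j k l : Fin 4} (hd : [i, j, k, l].Nodup)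
    (θ : ℝ) :
    IsAngleAlong (fun u w => B u w) (Submodule.span ℝ {p i, p j}) (p k) (p l) θ ↔
      θ = Real.arccos (-B (n k) (n l)) := by
  refine isAngleAlong_span_pair_iff B hs hnd
    (eq_sum_of_dual B (fun i => (hlam i).ne') (by simp [hV]) hnp) hd ?_ ?_ ?_ ?_ (h1 k) (h1 l)
    (hlt k l (ne_of_nodup hd)) θ
  · intro a ha; rw [hnp, if_neg ha.symm]
  · intro a ha; rw [hnp, if_neg ha.symm]
  · rw [hnp, if_pos rfl]; exact hlam k
  · rw [hnp, if_pos rfl]; exact hlam l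

theorem exists_normals_of_isAngleAlong [FiniteDimensional ℝ V] (hV : Module.finrank ℝ V = 4)
    (B : BilinForm ℝ V) (hs : ∀ u v, B u v = B v u) (hnd : ∀ v, (∀ w, B w v = 0) → v = 0)
    {p : Fin 4 → V} (hp : LinearIndependent ℝ p)
    (hpos : ∀ i v, v ≠ 0 → B v (p i) = 0 → 0 < B v v) {x : EdgeFun} (hx : x ∈ AS3)
    (h : ∀ i j k l, [i, j, k, l].Nodup →
      IsAngleAlong (fun u w => B u w) (Submodule.span ℝ {p i, p j}) (p k) (p l) (x i j)) :
    ∃ (n : Fin 4 → V) (lam : Fin 4 → ℝ), (∀ i, 0 < lam i) ∧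
      (∀ i j, B (n i) (p j) = if i = j then lam i else 0) ∧
      ∀ k l, B (n k) (n l) = gram x k l := by
  obtain ⟨n, lam, hlam, hnp, h1, hlt⟩ := exists_unit_normals hV B hs hnd hp hpos
  refine ⟨n, lam, hlam, hnp, gram_eq_of_arccos hx h1 hlt fun i j k l hd => ?_⟩
  exact (isAngleAlong_iff_of_dual hV B hs hnd hlam hnp h1 hlt hd _).1 (h i j k l hd)

/-- Products of the vertices are cofactors of the Gram matrix of the normals, up to factors. -/
theorem adjugate_apply_of_dual [FiniteDimensional ℝ V] (hV : Module.finrank ℝ V = 4)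
    (B : BilinForm ℝ V) (hs : ∀ u v, B u v = B v u)
    {n p : Fin 4 → V} {lam : Fin 4 → ℝ} (hlam : ∀ i, 0 < lam i)
    (hnp : ∀ i j, B (n i) (p j) = if i = j then lam i else 0) {G : Matrix (Fin 4) (Fin 4) ℝ}
    (hG : ∀ k l, B (n k) (n l) = G k l) :
    G.det ≠ 0 ∧ ∀ i j, G.adjugate i j = G.det * ((lam i)⁻¹ * (lam j)⁻¹ * B (p i) (p j)) := by
  have hpn : ∀ i j, B (p i) (n j) = if i = j then lam i else 0 := by
    intro i j
    rw [hs, hnp]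
    by_cases h : i = j
    · simp [h]
    · simp [h, Ne.symm h]
  -- After rescaling by the `lam i`, the vertices are the dual basis of the normals, so their Gram
  -- matrix is the inverse of `G`.
  have hGM : G * Matrix.of (fun i j => (lam i)⁻¹ * (lam j)⁻¹ * B (p i) (p j)) = 1 := by
    ext i j
    have := eq_sum_of_dual B (fun i => (hlam i).ne') (by simp [hV]) hpn (p j)
    have h2 := hnp i j
    rw [this, map_sum] at h2
    rw [mul_apply, one_apply]
    rw [← mul_left_inj' (hlam j).ne', Finset.sum_mul]
    refine Eq.trans (Finset.sum_congr rfl fun a _ => ?_) (h2.trans ?_)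
    · have h3 := (hlam j).ne'
      rw [map_smul, smul_eq_mul, hG, of_apply]
      field_simp
    · split_ifs with h
      · rw [h, one_mul]
      · rw [zero_mul]
  have hdet : G.det ≠ 0 := by
    intro h
    have := congrArg Matrix.det hGM
    rw [det_mul, h] at this
    simp at this
  refine ⟨hdet, fun i j => ?_⟩
  have h2 : G.adjugate = G.det • Matrix.of (fun i j => (lam i)⁻¹ * (lam j)⁻¹ * B (p i) (p j)) := by
    rw [← mul_one G.adjugate, ← hGM, ← mul_assoc, adjugate_mul, smul_mul, one_mul]
  rw [h2]; rfl

end Common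

/-! ### Spherical tetrahedra -/

section Spherical

theorem det_gram_pos_of_spherical {n : Fin 4 → EuclideanSpace ℝ (Fin 4)}
    {G : Matrix (Fin 4) (Fin 4) ℝ} (hG : ∀ k l, inner ℝ (n k) (n l) = G k l) (h0 : G.det ≠ 0) :
    0 < G.det := by
  have : G = (Matrix.of fun i j => n i j) * (Matrix.of fun i j => n i j).transpose := by
    ext k l
    rw [← hG, mul_apply, PiLp.inner_apply]
    simp [mul_comm]
  rw [this, det_mul, det_transpose] at h0 ⊢
  exact lt_of_le_of_ne (mul_self_nonneg _) (Ne.symm h0)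

theorem det_pos_of_mem_S3 {x : EdgeFun} (hx : x ∈ S3) : 0 < (gram x).det := by
  obtain ⟨hA, p, hp1, hp, hang⟩ := hx
  have hs : ∀ u v : EuclideanSpace ℝ (Fin 4), innerₗ _ u v = innerₗ _ v u := fun u v =>
    real_inner_comm v u
  obtain ⟨n, lam, hlam, hnp, hG⟩ := exists_normals_of_isAngleAlong (by simp)
    (innerₗ (EuclideanSpace ℝ (Fin 4))) hs
    (fun v hv => inner_self_eq_zero.1 (hv v)) hp
    (fun i v hv _ => real_inner_self_pos.2 hv) hA hang
  exact det_gram_pos_of_spherical hG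
    (adjugate_apply_of_dual (by simp) (innerₗ (EuclideanSpace ℝ (Fin 4))) hs hlam hnp hG).1

theorem mem_S3_of_normals {x : EdgeFun} (hx : x ∈ AS3) {n : Fin 4 → EuclideanSpace ℝ (Fin 4)}
    (hG : ∀ k l, inner ℝ (n k) (n l) = gram x k l) (h0 : (gram x).det ≠ 0) : x ∈ S3 := by
  have hs : ∀ u v : EuclideanSpace ℝ (Fin 4), innerₗ _ u v = innerₗ _ v u := fun u v =>
    real_inner_comm v u
  obtain ⟨q, hq, -⟩ := exists_dual (innerₗ (EuclideanSpace ℝ (Fin 4))) hG (gram_transpose x) h0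
  have hq0 : ∀ i, q i ≠ 0 := by
    intro i h
    have := hq i i
    simp [h] at this
  have hc : ∀ i, 0 < ‖q i‖⁻¹ := fun i => inv_pos.2 (norm_pos_iff.2 (hq0 i))
  have hnp : ∀ i j, innerₗ (EuclideanSpace ℝ (Fin 4)) (n i) (‖q j‖⁻¹ • q j) =
      if i = j then ‖q i‖⁻¹ else 0 := by
    intro i j
    rw [map_smul, hq]
    split_ifs with h <;> simp [h]
  refine ⟨hx, fun i => ‖q i‖⁻¹ • q i, fun i => ?_,
    linearIndependent_of_dual _ (fun i => (hc i).ne') hnp, fun i j k l hd => ?_⟩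
  · simp [norm_smul, hq0]
  · refine (isAngleAlong_iff_of_dual (by simp) (innerₗ (EuclideanSpace ℝ (Fin 4))) hs
      (fun v hv => inner_self_eq_zero.1 (hv v)) hc hnp ?_ ?_ hd _).2
      (arccos_of_gram_eq (B := innerₗ (EuclideanSpace ℝ (Fin 4))) hx hG hd)
    · intro i; exact (hG i i).trans (gram_diag x i)
    · intro i j hij
      exact (congrArg (· ^ 2) (hG i j)).trans_lt (gram_sq_lt hx hij)

end Spherical

/-! ### Hyperbolic tetrahedra -/

section Hyperbolic

/-- The Lorentzian inner product as a bilinear form. -/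
noncomputable def lorentzForm : BilinForm ℝ (Fin 4 → ℝ) :=
  LinearMap.mk₂ ℝ lorentz
    (by intro a b c; simp only [lorentz, Pi.add_apply]; ring)
    (by intro a b c; simp only [lorentz, Pi.smul_apply, smul_eq_mul]; ring)
    (by intro a b c; simp only [lorentz, Pi.add_apply]; ring)
    (by intro a b c; simp only [lorentz, Pi.smul_apply, smul_eq_mul]; ring)

theorem lorentzForm_apply (u w : Fin 4 → ℝ) : lorentzForm u w = lorentz u w := rfl

theorem lorentzForm_symm (u w : Fin 4 → ℝ) : lorentzForm u w = lorentzForm w u := by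
  simp only [lorentzForm_apply, lorentz]; ring

theorem lorentzForm_nondeg (v : Fin 4 → ℝ) (h : ∀ w, lorentzForm w v = 0) : v = 0 := by
  ext i
  have := h (Pi.single i 1)
  fin_cases i <;> simpa [lorentzForm_apply, lorentz] using this

theorem cauchy_three (a b c x y z : ℝ) :
    (a * x + b * y + c * z) ^ 2 ≤ (a ^ 2 + b ^ 2 + c ^ 2) * (x ^ 2 + y ^ 2 + z ^ 2) := by
  nlinarith [sq_nonneg (a * y - b * x), sq_nonneg (a * z - c * x), sq_nonneg (b * z - c * y)]

/-- Two future timelike vectors have negative product. -/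
theorem lorentz_neg_of_timelike {p q : Fin 4 → ℝ} (hp : lorentz p p < 0) (hq : lorentz q q < 0)
    (hp0 : 0 < p 0) (hq0 : 0 < q 0) : lorentz p q < 0 := by
  unfold lorentz at *
  have h := cauchy_three (p 1) (p 2) (p 3) (q 1) (q 2) (q 3)
  have h2 : (p 1 * q 1 + p 2 * q 2 + p 3 * q 3) ^ 2 < (p 0 * q 0) ^ 2 := by
    refine h.trans_lt ?_
    have e1 : p 1 ^ 2 + p 2 ^ 2 + p 3 ^ 2 < p 0 ^ 2 := by linarith
    have e2 : q 1 ^ 2 + q 2 ^ 2 + q 3 ^ 2 < q 0 ^ 2 := by linarith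
    rw [mul_pow]
    exact mul_lt_mul'' e1 e2 (by positivity) (by positivity)
  have := abs_lt_of_sq_lt_sq h2 (by positivity)
  linarith [(abs_lt.1 this).2]

/-- The complement of a timelike vector is spacelike. -/
theorem lorentz_pos_of_orthogonal {p v : Fin 4 → ℝ} (hp : lorentz p p < 0) (hv : v ≠ 0)
    (h : lorentz v p = 0) : 0 < lorentz v v := by
  unfold lorentz at *
  have hc := cauchy_three (v 1) (v 2) (v 3) (p 1) (p 2) (p 3)
  have e0 : v 1 * p 1 + v 2 * p 2 + v 3 * p 3 = v 0 * p 0 := by linarith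
  rw [e0] at hc
  have e1 : p 1 ^ 2 + p 2 ^ 2 + p 3 ^ 2 < p 0 ^ 2 := by linarith
  have hp0 : 0 < p 0 ^ 2 := lt_of_le_of_lt (by positivity) e1
  rcases eq_or_lt_of_le (show 0 ≤ v 1 ^ 2 + v 2 ^ 2 + v 3 ^ 2 by positivity) with hz | hz
  · exfalso
    apply hv
    have h1 : v 1 = 0 := by nlinarith [sq_nonneg (v 1), sq_nonneg (v 2), sq_nonneg (v 3)]
    have h2 : v 2 = 0 := by nlinarith [sq_nonneg (v 1), sq_nonneg (v 2), sq_nonneg (v 3)]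
    have h3 : v 3 = 0 := by nlinarith [sq_nonneg (v 1), sq_nonneg (v 2), sq_nonneg (v 3)]
    have hp0' : p 0 ≠ 0 := fun h => by simp [h] at hp0
    have h0 : v 0 = 0 := by
      rw [h1, h2, h3] at e0
      simpa [hp0'] using e0.symm
    ext i; fin_cases i <;> simpa
  · have : v 0 ^ 2 * p 0 ^ 2 < (v 1 ^ 2 + v 2 ^ 2 + v 3 ^ 2) * p 0 ^ 2 := by
      rw [← mul_pow]
      exact hc.trans_lt (mul_lt_mul_of_pos_left e1 hz)
    have := lt_of_mul_lt_mul_right this hp0.le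
    linarith

theorem det_gram_neg_of_lorentz {n : Fin 4 → Fin 4 → ℝ} {G : Matrix (Fin 4) (Fin 4) ℝ}
    (hG : ∀ k l, lorentzForm (n k) (n l) = G k l) (h0 : G.det ≠ 0) : G.det < 0 := by
  have : G = Matrix.of n * diagonal ![-1, 1, 1, 1] * (Matrix.of n).transpose := by
    ext k l
    rw [← hG, mul_apply]
    simp [Fin.sum_univ_four, lorentzForm_apply, lorentz]
  have hd : G.det = -((Matrix.of n).det * (Matrix.of n).det) := by
    rw [this, det_mul, det_mul, det_transpose, det_diagonal]
    simp [Fin.prod_univ_four]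
  rw [hd] at h0 ⊢
  have := lt_of_le_of_ne (mul_self_nonneg (Matrix.of n).det) (Ne.symm (neg_ne_zero.1 h0))
  linarith

/-- Up to positive factors a cofactor is `det` times the product of two vertices. Both are negative:
the form has signature `(3, 1)`, and the vertices are future timelike. -/
theorem adjugate_pos_of_mem_H3 {x : EdgeFun} (hx : x ∈ H3) :
    (gram x).det < 0 ∧ ∀ i j, 0 < (gram x).adjugate i j := by
  obtain ⟨hA, p, hp1, hp, hang⟩ := hx
  have htl : ∀ i, lorentz (p i) (p i) < 0 := fun i => by rw [(hp1 i).1]; norm_num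
  obtain ⟨n, lam, hlam, hnp, hG⟩ := exists_normals_of_isAngleAlong (by simp)
    lorentzForm lorentzForm_symm lorentzForm_nondeg hp
    (fun i v hv h => lorentz_pos_of_orthogonal (htl i) hv h) hA hang
  obtain ⟨h0, hadj⟩ := adjugate_apply_of_dual (by simp) lorentzForm lorentzForm_symm hlam hnp hG
  have hdet := det_gram_neg_of_lorentz hG h0
  refine ⟨hdet, fun i j => ?_⟩
  rw [hadj]
  have := lorentz_neg_of_timelike (htl i) (htl j) (hp1 i).2 (hp1 j).2
  exact mul_pos_of_neg_of_neg hdet (mul_neg_of_pos_of_neg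
    (mul_pos (inv_pos.2 (hlam i)) (inv_pos.2 (hlam j))) this)

/-- The dual basis `q` has Gram matrix `G⁻¹`, whose entries are negative. So all `q i` are timelike
and lie in the same nappe of the light cone; normalising them, after a common sign change if needed,
gives the vertices. -/
theorem mem_H3_of_normals {x : EdgeFun} (hx : x ∈ AS3) {n : Fin 4 → Fin 4 → ℝ}
    (hG : ∀ k l, lorentzForm (n k) (n l) = gram x k l) (h0 : (gram x).det ≠ 0)
    (hadj : ∀ i j, 0 < (gram x).adjugate i j) : x ∈ H3 := by
  have hdet := det_gram_neg_of_lorentz hG h0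
  obtain ⟨q, hq, hqq⟩ := exists_dual lorentzForm hG (gram_transpose x) h0
  have hneg : ∀ i j, lorentz (q i) (q j) < 0 := by
    intro i j
    have := hqq i j
    rw [lorentzForm_apply] at this
    rw [this, inv_def, Ring.inverse_eq_inv', Matrix.smul_apply, smul_eq_mul]
    exact mul_neg_of_neg_of_pos (inv_lt_zero.2 hdet) (hadj i j)
  have hq0 : ∀ i, q i 0 ≠ 0 := by
    intro i h
    have := hneg i i
    simp only [lorentz, h] at this
    nlinarith [mul_self_nonneg (q i 1), mul_self_nonneg (q i 2), mul_self_nonneg (q i 3)]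
  have hsame : ∀ i j, 0 < q i 0 → 0 < q j 0 := by
    intro i j hi
    by_contra hj
    have hj' : 0 < (-q j) 0 := by
      have := lt_of_le_of_ne (not_lt.1 hj) (hq0 j)
      simpa using this
    have h1 : lorentz (-q j) (-q j) < 0 := by
      have := hneg j j
      simpa [lorentz] using this
    have h2 := lorentz_neg_of_timelike (hneg i i) h1 hi hj'
    have h3 := hneg i j
    simp only [lorentz, Pi.neg_apply] at h2 h3
    linarith
  -- The sign `σ` moves the common nappe to the future. It is applied to the normals as well, which
  -- preserves both the duality and the Gram matrix.
  obtain ⟨σ, hσ, hpos⟩ : ∃ σ : ℝ, σ * σ = 1 ∧ ∀ i, 0 < σ * q i 0 := by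
    by_cases h : ∃ i, 0 < q i 0
    · obtain ⟨i, hi⟩ := h
      exact ⟨1, by norm_num, fun j => by simpa using hsame i j hi⟩
    · push Not at h
      refine ⟨-1, by norm_num, fun j => ?_⟩
      have := lt_of_le_of_ne (h j) (hq0 j)
      linarith
  have hsq : ∀ i, 0 < √(-lorentz (q i) (q i)) := fun i => Real.sqrt_pos.2 (by linarith [hneg i i])
  set c : Fin 4 → ℝ := fun i => (√(-lorentz (q i) (q i)))⁻¹ with hcdef
  have hc : ∀ i, 0 < c i := fun i => inv_pos.2 (hsq i)
  have hcc : ∀ i, c i * c i * lorentz (q i) (q i) = -1 := by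
    intro i
    have h1 := Real.mul_self_sqrt (show 0 ≤ -lorentz (q i) (q i) by linarith [hneg i i])
    have h2 := (hsq i).ne'
    simp only [hcdef]
    field_simp
    linarith
  have hnp : ∀ i j, lorentzForm (σ • n i) ((σ * c j) • q j) = if i = j then c i else 0 := by
    intro i j
    rw [map_smul, map_smul, LinearMap.smul_apply, hq]
    split_ifs with h
    · subst h
      simp only [smul_eq_mul]
      linear_combination c i * hσ
    · simp
  have hG' : ∀ k l, lorentzForm (σ • n k) (σ • n l) = gram x k l := by
    intro k l
    rw [map_smul, map_smul, LinearMap.smul_apply, hG, smul_smul, hσ, one_smul]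
  refine ⟨hx, fun i => (σ * c i) • q i, fun i => ⟨?_, ?_⟩,
    linearIndependent_of_dual _ (fun i => (hc i).ne') hnp, fun i j k l hd => ?_⟩
  · rw [← hcc i]
    simp only [lorentz, Pi.smul_apply, smul_eq_mul]
    linear_combination (c i * c i * (-(q i 0 * q i 0) + q i 1 * q i 1 + q i 2 * q i 2
      + q i 3 * q i 3)) * hσ
  · have := mul_pos (hc i) (hpos i)
    simp only [Pi.smul_apply, smul_eq_mul]
    linarith
  · refine (isAngleAlong_iff_of_dual (by simp) lorentzForm lorentzForm_symm lorentzForm_nondeg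
      hc hnp ?_ ?_ hd _).2 (arccos_of_gram_eq hx hG' hd)
    · intro i; rw [hG', gram_diag]
    · intro i j hij; rw [hG']; exact gram_sq_lt hx hij

end Hyperbolic

/-! ### Euclidean tetrahedra -/

section Euclidean

local notation "E³" => EuclideanSpace ℝ (Fin 3)

theorem eq_sum_of_euclidean_normals {n p : Fin 4 → E³} {lam : Fin 4 → ℝ} (hlam : ∀ i, 0 < lam i)
    (hnp : ∀ a b c, inner ℝ (n a) (p b - p c) =
      (if a = b then lam a else 0) - (if a = c then lam a else 0)) (i : Fin 4) (w : E³) :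
    w = ∑ a, ((lam a)⁻¹ * inner ℝ (n a) w) • (p a - p i) := by
  have h := eq_sum_of_dual (innerₗ E³) (ι := Fin 3) (n := fun a => n (i.succAbove a))
    (p := fun a => p (i.succAbove a) - p i) (lam := fun a => lam (i.succAbove a))
    (fun a => (hlam _).ne') (by simp) (fun a b => by
      rw [innerₗ_apply_apply, hnp]
      simp) w
  rw [Fin.sum_univ_succAbove _ i]
  simpa using h

theorem affineIndependent_of_normals {n p : Fin 4 → E³} {lam : Fin 4 → ℝ} (hlam : ∀ i, 0 < lam i)
    (hnp : ∀ a b c, inner ℝ (n a) (p b - p c) =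
      (if a = b then lam a else 0) - (if a = c then lam a else 0)) : AffineIndependent ℝ p := by
  rw [affineIndependent_iff_linearIndependent_vsub ℝ p 0]
  refine linearIndependent_of_dual (innerₗ E³) (n := fun a : {a : Fin 4 // a ≠ 0} => n a)
    (lam := fun a => lam a) (fun a => (hlam _).ne') fun a b => ?_
  rw [innerₗ_apply_apply, vsub_eq_sub, hnp, if_neg a.2, sub_zero]
  simp only [Subtype.ext_iff]

theorem isAngleAlong_iff_of_euclidean_normals {n p : Fin 4 → E³} {lam : Fin 4 → ℝ}
    (hlam : ∀ i, 0 < lam i)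
    (hnp : ∀ a b c, inner ℝ (n a) (p b - p c) =
      (if a = b then lam a else 0) - (if a = c then lam a else 0))
    (h1 : ∀ i, inner ℝ (n i) (n i) = (1 : ℝ))
    (hlt : ∀ i j, i ≠ j → (inner ℝ (n i) (n j) : ℝ) ^ 2 < 1) {i j k l : Fin 4}
    (hd : [i, j, k, l].Nodup) (θ : ℝ) :
    IsAngleAlong (fun u w : E³ => inner ℝ u w) (Submodule.span ℝ {p j - p i})
      (p k - p i) (p l - p i) θ ↔ θ = Real.arccos (-inner ℝ (n k) (n l)) := by
  have hne : i ≠ k ∧ i ≠ l := by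
    simp only [List.nodup_cons, List.mem_cons, List.not_mem_nil, not_or] at hd
    tauto
  -- The vector of the base vertex `i` is zero, so the line becomes a span of a pair as in
  -- `isAngleAlong_span_pair_iff`.
  have hz : Submodule.span ℝ {p j - p i} = Submodule.span ℝ {p i - p i, p j - p i} := by
    rw [sub_self, Submodule.span_insert_zero]
  rw [hz]
  refine isAngleAlong_span_pair_iff (innerₗ E³) (e := fun a => p a - p i)
    (fun u v => real_inner_comm v u) (fun v hv => inner_self_eq_zero.1 (hv v))
    (eq_sum_of_euclidean_normals hlam hnp i) hd ?_ ?_ ?_ ?_ (h1 k) (h1 l)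
    (hlt k l (ne_of_nodup hd)) θ
  · intro a ha
    rw [innerₗ_apply_apply, hnp, if_neg ha.symm, if_neg hne.1.symm, sub_zero]
  · intro a ha
    rw [innerₗ_apply_apply, hnp, if_neg ha.symm, if_neg hne.2.symm, sub_zero]
  · rw [innerₗ_apply_apply, hnp, if_pos rfl, if_neg hne.1.symm, sub_zero]; exact hlam k
  · rw [innerₗ_apply_apply, hnp, if_pos rfl, if_neg hne.2.symm, sub_zero]; exact hlam l

/-- The normals are the normalised gradients of the barycentric coordinates; `lam a` is then the
height of the tetrahedron over face `a`. -/
theorem exists_euclidean_normals {p : Fin 4 → E³} (hp : AffineIndependent ℝ p) :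
    ∃ (n : Fin 4 → E³) (lam : Fin 4 → ℝ), (∀ i, 0 < lam i) ∧
      (∀ a b c, inner ℝ (n a) (p b - p c) =
        (if a = b then lam a else 0) - (if a = c then lam a else 0)) ∧
      (∀ i, inner ℝ (n i) (n i) = (1 : ℝ)) ∧
      ∀ i j, i ≠ j → (inner ℝ (n i) (n j) : ℝ) ^ 2 < 1 := by
  let b : AffineBasis (Fin 4) ℝ E³ :=
    ⟨p, hp, (hp.affineSpan_eq_top_iff_card_eq_finrank_add_one).2 (by simp)⟩
  have hb : ∀ i, b i = p i := fun i => rfl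
  let m : Fin 4 → E³ := fun a =>
    (InnerProductSpace.toDual ℝ E³).symm (LinearMap.toContinuousLinearMap (b.coord a).linear)
  have hm : ∀ a b c, inner ℝ (m a) (p b - p c) =
      (if a = b then 1 else 0) - (if a = c then (1 : ℝ) else 0) := by
    intro a i j
    simp only [m, InnerProductSpace.toDual_symm_apply, LinearMap.coe_toContinuousLinearMap']
    rw [← vsub_eq_sub, AffineMap.linearMap_vsub, ← hb, ← hb, b.coord_apply, b.coord_apply,
      vsub_eq_sub]
  have hother : ∀ i : Fin 4, ∃ j, i ≠ j := by decide
  have hother2 : ∀ i j : Fin 4, ∃ k, i ≠ k ∧ j ≠ k := by decide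
  have hm0 : ∀ a, m a ≠ 0 := by
    intro a h
    obtain ⟨c, hc⟩ := hother a
    have := hm a a c
    simp [h, hc] at this
  have hc : ∀ a, 0 < ‖m a‖⁻¹ := fun a => inv_pos.2 (norm_pos_iff.2 (hm0 a))
  have hn : ∀ a b c, inner ℝ (‖m a‖⁻¹ • m a) (p b - p c) =
      (if a = b then ‖m a‖⁻¹ else 0) - (if a = c then ‖m a‖⁻¹ else 0) := by
    intro a b c
    rw [real_inner_smul_left, hm]
    split_ifs <;> simp
  have hn1 : ∀ a, inner ℝ (‖m a‖⁻¹ • m a) (‖m a‖⁻¹ • m a) = (1 : ℝ) := by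
    intro a
    rw [real_inner_self_eq_norm_sq, norm_smul, norm_inv, norm_norm,
      inv_mul_cancel₀ (norm_ne_zero_iff.2 (hm0 a)), one_pow]
  refine ⟨fun a => ‖m a‖⁻¹ • m a, fun a => ‖m a‖⁻¹, hc, hn, hn1, fun i j hij => ?_⟩
  obtain ⟨k, hik, hjk⟩ := hother2 i j
  generalize hN : (fun a => ‖m a‖⁻¹ • m a) = N
  have hNa : ∀ a, ‖m a‖⁻¹ • m a = N a := fun a => congrFun hN a
  simp only [hNa] at hn hn1 ⊢
  have hv : N i - (inner ℝ (N i) (N j) : ℝ) • N j ≠ 0 := by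
    intro h0
    have := congrArg (fun v : E³ => (inner ℝ v (p i - p k) : ℝ)) h0
    simp only [inner_sub_left, real_inner_smul_left, hn, inner_zero_left] at this
    simp [hik, hjk, hij.symm, hm0] at this
  have := real_inner_self_pos.2 hv
  simp only [inner_sub_left, inner_sub_right, real_inner_smul_left, real_inner_smul_right, hn1,
    real_inner_comm (N i) (N j)] at this
  nlinarith

/-- Replacing row `j` of `G` by the `j`-th unit vector gives a matrix of determinant `G.adjugate j
j` that kills `v`. Thus the kernel of `G` is at most a line. -/
theorem eq_zero_of_mulVec_eq_zero_of_cofactor {G : Matrix (Fin 4) (Fin 4) ℝ} {j : Fin 4}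
    (h : G.adjugate j j ≠ 0) {v : Fin 4 → ℝ} (hv : G *ᵥ v = 0) (hj : v j = 0) : v = 0 := by
  rw [adjugate_apply] at h
  refine eq_zero_of_mulVec_eq_zero h ?_
  ext i
  rcases eq_or_ne i j with rfl | hij
  · simp [mulVec, updateRow_self, hj]
  · simpa [mulVec, updateRow_ne hij] using congrFun hv i

/-- As `det G = 0`, the columns of the adjugate lie in the kernel, which is the line through `w`;
the positive diagonal entry fixes the sign of each multiple. -/
theorem adjugate_pos_of_kernel {G : Matrix (Fin 4) (Fin 4) ℝ}
    (h : ∀ i, 0 < G.adjugate i i) {w : Fin 4 → ℝ} (hw : ∀ i, 0 < w i) (hGw : G *ᵥ w = 0) :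
    G.det = 0 ∧ ∀ i j, 0 < G.adjugate i j := by
  have hdet : G.det = 0 := exists_mulVec_eq_zero_iff.1
    ⟨w, fun h0 => (hw 0).ne' (congrFun h0 0), hGw⟩
  refine ⟨hdet, fun i j => ?_⟩
  have hcol : G *ᵥ (fun a => G.adjugate a j) = 0 := by
    ext k
    have := congrFun (congrFun (mul_adjugate G) k) j
    rw [hdet, zero_smul, mul_apply] at this
    exact this
  have hv := eq_zero_of_mulVec_eq_zero_of_cofactor (h j).ne'
    (v := w j • (fun a => G.adjugate a j) - G.adjugate j j • w)
    (by rw [mulVec_sub, mulVec_smul, mulVec_smul, hcol, hGw]; simp)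
    (by simp [mul_comm])
  have := congrFun hv i
  simp only [Pi.sub_apply, Pi.smul_apply, smul_eq_mul, Pi.zero_apply] at this
  have h2 : 0 < w j * G.adjugate i j := by
    have := mul_pos (h j) (hw i)
    linarith
  exact (mul_pos_iff_of_pos_left (hw j)).1 h2

theorem adjugate_pos_of_mem_E3 {x : EdgeFun} (hx : x ∈ E3) :
    (gram x).det = 0 ∧ ∀ i j, 0 < (gram x).adjugate i j := by
  obtain ⟨hA, p, hp, hang⟩ := hx
  obtain ⟨n, lam, hlam, hnp, h1, hlt⟩ := exists_euclidean_normals hp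
  have hG : ∀ k l, inner ℝ (n k) (n l) = gram x k l :=
    gram_eq_of_arccos (B := innerₗ E³) hA h1 hlt fun i j k l hd =>
      (isAngleAlong_iff_of_euclidean_normals hlam hnp h1 hlt hd _).1 (hang i j k l hd)
  -- Minkowski's relation: the normals weighted by face areas, which are proportional to the inverse
  -- heights, sum to zero.
  have hy : ∑ a, (lam a)⁻¹ • n a = 0 := by
    rw [← inner_self_eq_zero (𝕜 := ℝ)]
    have hz : ∀ b, inner ℝ (∑ a, (lam a)⁻¹ • n a) (p b - p 0) = (0 : ℝ) := by
      intro b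
      rw [sum_inner]
      have : ∀ a, inner ℝ ((lam a)⁻¹ • n a) (p b - p 0) =
          (if a = b then (1 : ℝ) else 0) - (if a = 0 then (1 : ℝ) else 0) := by
        intro a
        have := (hlam a).ne'
        rw [real_inner_smul_left, hnp, mul_sub]
        split_ifs <;> simp [this]
      simp [this]
    nth_rewrite 2 [eq_sum_of_euclidean_normals hlam hnp 0 (∑ a, (lam a)⁻¹ • n a)]
    rw [inner_sum]
    exact Finset.sum_eq_zero fun b _ => by rw [real_inner_smul_right, hz, mul_zero]
  refine adjugate_pos_of_kernel (adjugate_gram_diag_pos hA) (w := fun a => (lam a)⁻¹)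
    (fun a => inv_pos.2 (hlam a)) ?_
  ext k
  have := congrArg (fun v : E³ => (inner ℝ (n k) v : ℝ)) hy
  simp only [inner_sum, real_inner_smul_right, hG, inner_zero_right] at this
  rw [Pi.zero_apply, ← this]
  simp only [mulVec, dotProduct, mul_comm]

/-- A column of the adjugate is a positive kernel vector `w`, hence a Minkowski relation between the
normals; the inverses of its entries serve as heights. -/
theorem mem_E3_of_normals {x : EdgeFun} (hx : x ∈ AS3) {n : Fin 4 → E³}
    (hG : ∀ k l, inner ℝ (n k) (n l) = gram x k l) (hdet : (gram x).det = 0)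
    (hadj : ∀ i j, 0 < (gram x).adjugate i j) : x ∈ E3 := by
  set w : Fin 4 → ℝ := fun a => (gram x).adjugate a 0 with hw
  have hw0 : ∀ a, 0 < w a := fun a => hadj a 0
  have hny : ∀ a, inner ℝ (n a) (∑ b, w b • n b) = (0 : ℝ) := by
    intro a
    have := congrFun (congrFun (mul_adjugate (gram x)) a) 0
    rw [hdet, zero_smul, mul_apply] at this
    simp only [inner_sum, real_inner_smul_right, hG]
    refine Eq.trans (Finset.sum_congr rfl fun b _ => mul_comm _ _) this
  have hy : ∑ b, w b • n b = 0 := by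
    rw [← inner_self_eq_zero (𝕜 := ℝ), sum_inner]
    exact Finset.sum_eq_zero fun b _ => by rw [real_inner_smul_left, hny, mul_zero]
  have hsub : ((gram x).submatrix Fin.succ Fin.succ).det ≠ 0 := by
    have := (hadj 0 0).ne'
    rw [adjugate_fin_succ_eq_det_submatrix] at this
    simpa using this
  obtain ⟨q, hq, -⟩ := exists_dual (innerₗ E³) (n := fun a : Fin 3 => n a.succ)
    (G := (gram x).submatrix Fin.succ Fin.succ) (fun i j => hG _ _)
    (by rw [transpose_submatrix, gram_transpose]) hsub
  simp only [innerₗ_apply_apply] at hq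
  -- Vertex `0` is the origin and the others are scaled dual vectors of the normals `1, 2, 3`. The
  -- relation `hy` forces all three to have product `-(w 0)⁻¹` with `n 0`, so face `0` is orthogonal
  -- to `n 0`.
  let p : Fin 4 → E³ := Fin.cons 0 fun b => (w b.succ)⁻¹ • q b
  have hp0 : p 0 = 0 := rfl
  have hps : ∀ b : Fin 3, p b.succ = (w b.succ)⁻¹ • q b := fun b => rfl
  have hnp0 : ∀ a b, inner ℝ (n a) (p b) =
      (if a = b then (w a)⁻¹ else 0) - (if a = 0 then (w a)⁻¹ else 0) := by
    intro a b
    refine Fin.cases ?_ (fun b => ?_) b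
    · rw [hp0, inner_zero_right, sub_self]
    · refine Fin.cases ?_ (fun a => ?_) a
      · have h1 := congrArg (fun v : E³ => (inner ℝ v (p b.succ) : ℝ)) hy
        simp only [Fin.sum_univ_succ (fun b => w b • n b), inner_add_left, sum_inner,
          real_inner_smul_left, inner_zero_left] at h1
        have h2 : ∑ a : Fin 3, w a.succ * inner ℝ (n a.succ) (p b.succ) = (1 : ℝ) := by
          simp only [hps, real_inner_smul_right, hq]
          simp [(hw0 _).ne']
        rw [h2] at h1
        have h3 := (hw0 0).ne'
        rw [if_neg (Fin.succ_ne_zero b).symm, if_pos rfl, zero_sub]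
        field_simp
        linarith
      · rw [hps, real_inner_smul_right, hq, if_neg (Fin.succ_ne_zero a)]
        by_cases h : a = b
        · simp [h]
        · simp [h]
  have hnp : ∀ a b c, inner ℝ (n a) (p b - p c) =
      (if a = b then (w a)⁻¹ else 0) - (if a = c then (w a)⁻¹ else 0) := by
    intro a b c
    rw [inner_sub_right, hnp0, hnp0, sub_sub_sub_cancel_right]
  have hlam : ∀ a, 0 < (w a)⁻¹ := fun a => inv_pos.2 (hw0 a)
  refine ⟨hx, p, affineIndependent_of_normals hlam hnp, fun i j k l hd => ?_⟩
  refine (isAngleAlong_iff_of_euclidean_normals (lam := fun a => (w a)⁻¹) hlam hnp ?_ ?_ hd _).2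
    (arccos_of_gram_eq (B := innerₗ E³) hx hG hd)
  · intro i; rw [hG, gram_diag]
  · intro i j hij; rw [hG]; exact gram_sq_lt hx hij

end Euclidean

/-! ### Realization by vectors and the trichotomy -/

/-- The Gram matrix of an angle structure is that of vectors in `ℝ⁴` for a form of signature
`(4, 0)`, `(3, 0)` or `(3, 1)`. -/
theorem exists_realization {x : EdgeFun} (hx : x ∈ AS3) :
    ∃ (ε : ℝ) (u : Fin 4 → Fin 4 → ℝ), (ε = 1 ∨ ε = 0 ∨ ε = -1) ∧ (Matrix.of u).det ≠ 0 ∧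
      ∀ k l, ε * (u k 0 * u l 0) + u k 1 * u l 1 + u k 2 * u l 2 + u k 3 * u l 3
        = gram x k l := by
  have hsymm : ∀ a b, gram x a b = gram x b a := fun a b =>
    congrFun (congrFun (gram_transpose x) b) a
  have h3 := adjugate_gram_diag_pos hx 3
  have ha := gram_sq_lt hx (show (0 : Fin 4) ≠ 1 by decide)
  rw [adjugate_fin_succ_eq_det_submatrix, det_fin_three] at h3
  simp only [submatrix_apply, show (3 : Fin 4).succAbove 0 = 0 by rfl,
    show (3 : Fin 4).succAbove 1 = 1 by rfl, show (3 : Fin 4).succAbove 2 = 2 by rfl, gram_diag,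
    hsymm 1 0, hsymm 2 0, hsymm 2 1] at h3
  norm_num at h3
  have hd := fun k => gram_diag x k
  set G := gram x
  -- Gram–Schmidt on the first three normals, in the last three coordinates; positivity of the
  -- cofactor at `3` makes `t` real and nonzero.
  set s := √(1 - G 0 1 ^ 2) with hs
  have hs0 : 0 < s := Real.sqrt_pos.2 (by linarith)
  have hs2 : s ^ 2 = 1 - G 0 1 ^ 2 := Real.sq_sqrt (by linarith)
  set y := (G 1 2 - G 0 1 * G 0 2) / s with hy
  have hsy : s * y = G 1 2 - G 0 1 * G 0 2 := by rw [hy]; field_simp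
  have ht : 0 < 1 - G 0 2 ^ 2 - y ^ 2 := by
    have : 0 < s ^ 2 * (1 - G 0 2 ^ 2 - y ^ 2) := by
      have e : s ^ 2 * y ^ 2 = (G 1 2 - G 0 1 * G 0 2) ^ 2 := by rw [← hsy]; ring
      rw [mul_sub, e, hs2]
      linarith
    exact (mul_pos_iff_of_pos_left (by positivity)).1 this
  set t := √(1 - G 0 2 ^ 2 - y ^ 2)
  have ht0 : 0 < t := Real.sqrt_pos.2 ht
  have ht2 : t ^ 2 = 1 - G 0 2 ^ 2 - y ^ 2 := Real.sq_sqrt ht.le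
  obtain ⟨z, hz⟩ : ∃ z, s * z = G 1 3 - G 0 1 * G 0 3 :=
    ⟨(G 1 3 - G 0 1 * G 0 3) / s, by field_simp⟩
  obtain ⟨v, hv⟩ : ∃ v, t * v = G 2 3 - G 0 2 * G 0 3 - y * z :=
    ⟨(G 2 3 - G 0 2 * G 0 3 - y * z) / t, by field_simp⟩
  -- What remains of the square of the last normal may have any sign, recorded by `ε`. If it
  -- vanishes, `τ = 1` still keeps the four rows independent.
  obtain ⟨ε, τ, hε, hτ, hr⟩ : ∃ ε τ : ℝ, (ε = 1 ∨ ε = 0 ∨ ε = -1) ∧ τ ≠ 0 ∧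
      ε * (τ * τ) = 1 - G 0 3 ^ 2 - z ^ 2 - v ^ 2 := by
    generalize 1 - G 0 3 ^ 2 - z ^ 2 - v ^ 2 = r
    rcases lt_trichotomy r 0 with h | h | h
    · exact ⟨-1, √(-r), by simp, (Real.sqrt_pos.2 (by linarith)).ne', by
        rw [Real.mul_self_sqrt (by linarith)]; ring⟩
    · exact ⟨0, 1, by simp, one_ne_zero, by simp [h]⟩
    · exact ⟨1, √r, by simp, (Real.sqrt_pos.2 h).ne', by
        rw [Real.mul_self_sqrt h.le, one_mul]⟩
  refine ⟨ε, ![![0, 1, 0, 0], ![0, G 0 1, s, 0], ![0, G 0 2, y, t], ![τ, G 0 3, z, v]], hε, ?_, ?_⟩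
  · rw [det_succ_row_zero]
    simp [Fin.sum_univ_succ, det_fin_three, Fin.succAbove, hτ, hs0.ne', ht0.ne']
  · intro k l
    fin_cases k <;> fin_cases l <;>
      simp [hd, hsymm 1 0, hsymm 2 0, hsymm 2 1, hsymm 3 0, hsymm 3 1, hsymm 3 2] <;> linarith

theorem det_gram_of_realization {ε : ℝ} {u : Fin 4 → Fin 4 → ℝ} {G : Matrix (Fin 4) (Fin 4) ℝ}
    (hG : ∀ k l, ε * (u k 0 * u l 0) + u k 1 * u l 1 + u k 2 * u l 2 + u k 3 * u l 3 = G k l) :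
    G.det = ε * (Matrix.of u).det ^ 2 := by
  have : G = Matrix.of u * diagonal ![ε, 1, 1, 1] * (Matrix.of u).transpose := by
    ext k l
    rw [← hG, mul_apply]
    simp [Fin.sum_univ_four]
    ring
  rw [this, det_mul, det_mul, det_transpose, det_diagonal]
  simp [Fin.prod_univ_four]
  ring

/-- Among four signs the minority has size zero, one or two, and negating one sign or two distinct
ones makes all equal exactly in the matching case. -/
theorem bool_trichotomy : ∀ n : Fin 4 → Bool,
    ExactlyOne (∀ i j, n i = n j)
      (∃ a, ∀ i j, (n i ^^ decide (i = a)) = (n j ^^ decide (j = a)))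
      (∃ a b, a ≠ b ∧ ∀ i j, (n i ^^ (decide (i = a) ^^ decide (i = b))) =
        (n j ^^ (decide (j = a) ^^ decide (j = b)))) := by
  unfold ExactlyOne
  decide

theorem exists_normals_of_realization {x : EdgeFun} {ε : ℝ} {u : Fin 4 → Fin 4 → ℝ}
    (hu : ∀ k l, ε * (u k 0 * u l 0) + u k 1 * u l 1 + u k 2 * u l 2 + u k 3 * u l 3
      = gram x k l) (hε : ε = 0) :
    ∃ n : Fin 4 → EuclideanSpace ℝ (Fin 3), ∀ k l, inner ℝ (n k) (n l) = gram x k l := by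
  refine ⟨fun k => !₂[u k 1, u k 2, u k 3], fun k l => ?_⟩
  rw [← hu, hε, PiLp.inner_apply, Fin.sum_univ_three]
  simp
  ring

theorem mem_S3_iff {x : EdgeFun} (hx : x ∈ AS3) : x ∈ S3 ↔ 0 < (gram x).det := by
  refine ⟨det_pos_of_mem_S3, fun h => ?_⟩
  obtain ⟨ε, u, hε, hdet, hu⟩ := exists_realization hx
  have hd := det_gram_of_realization hu
  have hε1 : ε = 1 := by
    rcases hε with h1 | h1 | h1
    · exact h1
    · rw [hd, h1] at h; simp at h
    · rw [hd, h1] at h; linarith [sq_nonneg (Matrix.of u).det]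
  refine mem_S3_of_normals hx (n := fun k => WithLp.toLp 2 (u k)) (fun k l => ?_) h.ne'
  rw [← hu, hε1, PiLp.inner_apply, Fin.sum_univ_four]
  simp
  ring

/-- The determinant has the sign of `ε`, so `det ≤ 0` leaves the degenerate form, which gives
Euclidean normals, and the Lorentzian one. -/
theorem mem_E3_union_H3_iff {x : EdgeFun} (hx : x ∈ AS3) :
    x ∈ E3 ∪ H3 ↔ (gram x).det ≤ 0 ∧ ∀ i j, 0 < (gram x).adjugate i j := by
  constructor
  · rintro (h | h)
    · exact ⟨(adjugate_pos_of_mem_E3 h).1.le, (adjugate_pos_of_mem_E3 h).2⟩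
    · exact ⟨(adjugate_pos_of_mem_H3 h).1.le, (adjugate_pos_of_mem_H3 h).2⟩
  · rintro ⟨h, hadj⟩
    obtain ⟨ε, u, hε, hdet, hu⟩ := exists_realization hx
    have hd := det_gram_of_realization hu
    have hsq : 0 < (Matrix.of u).det ^ 2 := by positivity
    rcases hε with h1 | h1 | h1
    · rw [hd, h1] at h; linarith
    · left
      obtain ⟨n, hn⟩ := exists_normals_of_realization hu h1
      exact mem_E3_of_normals hx hn (by rw [hd, h1, zero_mul]) hadj
    · right
      refine mem_H3_of_normals hx (n := u) (fun k l => ?_) (by rw [hd, h1]; linarith) hadj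
      rw [← hu, h1, lorentzForm_apply, lorentz]
      ring

theorem adjugate_gram_symm (x : EdgeFun) (i j : Fin 4) :
    (gram x).adjugate i j = (gram x).adjugate j i := by
  conv_lhs => rw [← gram_transpose x, ← adjugate_transpose, transpose_apply]

/-- The sign vector is row `0` of the adjugate: positivity of the triple product for `0, i, j` makes
the sign of entry `i j` the product of the signs of entries `0 i` and `0 j`. -/
theorem adjugate_pos_iff {x : EdgeFun} (hx : x ∈ AS3) (hd : (gram x).det ≤ 0) (i j : Fin 4) :
    (gram x).adjugate i j ≠ 0 ∧ (0 < (gram x).adjugate i j ↔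
      decide ((gram x).adjugate 0 i < 0) = decide ((gram x).adjugate 0 j < 0)) := by
  have hne : ∀ i j, (gram x).adjugate i j ≠ 0 := by
    intro i j
    rcases eq_or_ne i j with rfl | hij
    · exact (adjugate_gram_diag_pos hx i).ne'
    · obtain ⟨k, l, h⟩ := exists_complement hij
      exact (adjugate_gram_signs hx hd (show [i, j, k, l].Nodup by
        revert h; revert i j k l; decide)).1
  have h00 : ¬ (gram x).adjugate 0 0 < 0 := (adjugate_gram_diag_pos hx 0).not_gt
  refine ⟨hne i j, ?_⟩
  rw [decide_eq_decide]
  have hpos : ∀ i j, ¬ (gram x).adjugate i j < 0 ↔ 0 < (gram x).adjugate i j := fun i j =>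
    ⟨fun h => lt_of_le_of_ne (not_lt.1 h) (hne i j).symm, fun h => h.not_gt⟩
  rcases eq_or_ne i j with rfl | hij
  · simp [adjugate_gram_diag_pos hx i]
  rcases eq_or_ne i 0 with rfl | hi
  · rw [← hpos]; tauto
  rcases eq_or_ne j 0 with rfl | hj
  · rw [← hpos, adjugate_gram_symm]; tauto
  obtain ⟨l, hl⟩ : ∃ l, [0, i, j, l].Nodup := by
    clear hpos hne h00 hd hx
    revert i j; decide
  have h := (adjugate_gram_signs hx hd hl).2
  constructor
  · intro h1
    have h2 := (mul_pos_iff_of_pos_right h1).1 h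
    rcases mul_pos_iff.1 h2 with h3 | h3
    · exact ⟨fun h => absurd h h3.1.not_gt, fun h => absurd h h3.2.not_gt⟩
    · exact ⟨fun _ => h3.2, fun _ => h3.1⟩
  · intro h1
    refine (mul_pos_iff_of_pos_left ?_).1 h
    by_cases h2 : (gram x).adjugate 0 i < 0
    · exact mul_pos_of_neg_of_neg h2 (h1.1 h2)
    · exact mul_pos ((hpos _ _).1 h2) ((hpos _ _).1 fun h3 => h2 (h1.2 h3))

/-- Membership of a repeatedly flipped angle structure, in terms of the signs of the cofactors. -/
theorem mem_E3_union_H3_iff_of_signs {x y : EdgeFun} (hx : x ∈ AS3) (hd : (gram x).det ≤ 0)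
    (hy : y ∈ AS3) (e : Fin 4 → Bool)
    (h : ∀ k l, gram y k l = (if e k then -1 else 1) * (if e l then -1 else 1) * gram x k l) :
    y ∈ E3 ∪ H3 ↔ ∀ i j, (decide ((gram x).adjugate 0 i < 0) ^^ e i) =
      (decide ((gram x).adjugate 0 j < 0) ^^ e j) := by
  obtain ⟨hdet, hadj⟩ := det_of_signs (ε := fun k => if e k then -1 else 1)
    (fun k => by split_ifs <;> norm_num) h
  rw [mem_E3_union_H3_iff hy, hdet, and_iff_right hd]
  refine forall_congr' fun i => forall_congr' fun j => ?_
  obtain ⟨hne, hiff⟩ := adjugate_pos_iff hx hd i j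
  rw [hadj]
  generalize decide ((gram x).adjugate 0 i < 0) = a at *
  generalize decide ((gram x).adjugate 0 j < 0) = b at *
  have hneg : (gram x).adjugate i j < 0 ↔ a ≠ b := by
    rw [Ne, ← hiff, not_lt]
    exact ⟨le_of_lt, fun h => lt_of_le_of_ne h hne⟩
  cases hi : e i <;> cases hj : e j <;> simp [hiff, hneg]
  · cases a <;> cases b <;> simp
  · cases a <;> cases b <;> simp

theorem exactlyOne_of_mem_AS3 {x : EdgeFun} (hx : x ∈ AS3) :
    ExactlyOne (x ∈ E3 ∪ H3 ∪ S3) (∃ i : Fin 4, flip i x ∈ E3 ∪ H3)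
      (∃ i j : Fin 4, i ≠ j ∧ flip i (flip j x) ∈ E3 ∪ H3) := by
  have hflip : ∀ a, flip a x ∈ AS3 := flip_mem_AS3 hx
  have hflip2 : ∀ a b, flip a (flip b x) ∈ AS3 := fun a b => flip_mem_AS3 (hflip b) a
  have hg1 : ∀ a k l, gram (flip a x) k l = (if decide (k = a) then -1 else 1) *
      (if decide (l = a) then -1 else 1) * gram x k l := by
    intro a k l
    simp [gram_flip]
  have hg2 : ∀ a b k l, gram (flip a (flip b x)) k l =
      (if decide (k = a) ^^ decide (k = b) then -1 else 1) *
      (if decide (l = a) ^^ decide (l = b) then -1 else 1) * gram x k l := by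
    intro a b k l
    have hxor : ∀ p q : Bool, (if p ^^ q then (-1 : ℝ) else 1) =
        (if p then -1 else 1) * (if q then -1 else 1) := by
      intro p q
      cases p <;> cases q <;> simp
    rw [hxor, hxor, gram_flip, gram_flip]
    simp only [decide_eq_true_eq]
    ring
  by_cases hd : (gram x).det ≤ 0
  · have h0 : x ∈ E3 ∪ H3 ∪ S3 ↔ _ := (or_iff_left fun h =>
      hd.not_gt ((mem_S3_iff hx).1 h)).trans
        (mem_E3_union_H3_iff_of_signs hx hd hx (fun _ => false) (by simp))
    rw [h0]
    simp only [mem_E3_union_H3_iff_of_signs hx hd (hflip _) (fun k => decide (k = _)) (hg1 _),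
      mem_E3_union_H3_iff_of_signs hx hd (hflip2 _ _)
        (fun k => decide (k = _) ^^ decide (k = _)) (hg2 _ _), Bool.xor_false]
    exact bool_trichotomy fun i => decide ((gram x).adjugate 0 i < 0)
  · left
    -- Flips preserve the determinant, so a positive one excludes `E3 ∪ H3` after any flips.
    have hnot : ∀ {y : EdgeFun} {e : Fin 4 → Bool}, y ∈ AS3 → (∀ k l, gram y k l =
        (if e k then -1 else 1) * (if e l then -1 else 1) * gram x k l) → y ∉ E3 ∪ H3 := by
      intro y e hy h hm
      have := (mem_E3_union_H3_iff hy).1 hm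
      rw [(det_of_signs (ε := fun k => if e k then -1 else 1)
        (fun k => by split_ifs <;> norm_num) h).1] at this
      exact hd this.1
    refine ⟨Or.inr ((mem_S3_iff hx).2 (not_le.1 hd)), ?_, ?_⟩
    · rintro ⟨i, hi⟩
      exact hnot (e := fun k => decide (k = i)) (hflip i) (hg1 i) hi
    · rintro ⟨i, j, -, hij⟩
      exact hnot (e := fun k => decide (k = i) ^^ decide (k = j)) (hflip2 i j) (hg2 i j) hij

end TetAngle

theorem proposition6p1 (x : TetAngle.EdgeFun) (hx : x ∈ TetAngle.AS3) :
    TetAngle.ExactlyOne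
      (x ∈ TetAngle.E3 ∪ TetAngle.H3 ∪ TetAngle.S3)
      (∃ i : Fin 4, TetAngle.flip i x ∈ TetAngle.E3 ∪ TetAngle.H3)
      (∃ i j : Fin 4, i ≠ j ∧
        TetAngle.flip i (TetAngle.flip j x) ∈ TetAngle.E3 ∪ TetAngle.H3) :=
  TetAngle.exactlyOne_of_mem_AS3 hx
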